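/- Let $W$ denote the principal branch of the Lambert function on the real line, i.e. for $x\ge -1/e$ the number $W(x)$ is the unique real $w\ge -1$ with $we^{w}=x$. Call $f:(0,\infty)\to\mathbb R$ completely monotone if $f$ is infinitely differentiable and $(-1)^n f^{(n)}(x)\ge 0$ for all $n\ge 0$ and $x>0$; call $f$ a Bernstein function if it is nonnegative, infinitely differentiable, and $f'$ is completely monotone. Then: 1. $W(x)>0$ for all $x>0$; 2. $(-1)^{n-1}W^{(n)}(x)>0$ for all integers $n\ge 1$ and all $x>0$; 3. $W'$ is completely monotone on $(0,\infty)$; 4. $W$ is a Bernstein function on $(0,\infty)$. -/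

import Mathlib

open scoped ContDiff

/-- The map `w ↦ w eʷ` is strictly increasing on `[-1, ∞)`. -/
theorem strictMonoOn_mul_exp :
    StrictMonoOn (fun w : ℝ => w * Real.exp w) (Set.Ici (-1)) := by
  refine strictMonoOn_of_deriv_pos (convex_Ici _) (by fun_prop) fun w hw => ?_
  rw [interior_Ici, Set.mem_Ioi] at hw
  have h : HasDerivAt (fun w : ℝ => w * Real.exp w) (1 * Real.exp w + w * Real.exp w) w :=
    (hasDerivAt_id w).mul (Real.hasDerivAt_exp w)
  rw [h.deriv]
  have := Real.exp_pos w
  nlinarith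

/-- The principal branch `W = W₀` of the Lambert function on the real line: the inverse of
`w ↦ w eʷ` restricted to `[-1, ∞)`. It is meaningful for `x ≥ -e⁻¹`
(see `lambertW_spec`, `lambertW_unique`), and arbitrary for `x < -e⁻¹`. -/
noncomputable def lambertW (x : ℝ) : ℝ :=
  Function.invFunOn (fun w : ℝ => w * Real.exp w) (Set.Ici (-1)) x

/-- For `x ≥ -e⁻¹`, the number `W x` is at least `-1` and solves `w eʷ = x`. -/
theorem lambertW_spec {x : ℝ} (hx : -Real.exp (-1) ≤ x) :
    -1 ≤ lambertW x ∧ lambertW x * Real.exp (lambertW x) = x := by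
  have hex : ∃ w ∈ Set.Ici (-1 : ℝ), (fun w : ℝ => w * Real.exp w) w = x := by
    have hb : (-1 : ℝ) ≤ |x| := by linarith [abs_nonneg x]
    have hc : ContinuousOn (fun w : ℝ => w * Real.exp w) (Set.Icc (-1) |x|) := by fun_prop
    have hm : x ∈ Set.Icc ((fun w : ℝ => w * Real.exp w) (-1))
        ((fun w : ℝ => w * Real.exp w) |x|) := by
      refine ⟨by simpa using hx, (le_abs_self x).trans ?_⟩
      exact le_mul_of_one_le_right (abs_nonneg x) (Real.one_le_exp (abs_nonneg x))
    obtain ⟨w, hw, hwx⟩ := intermediate_value_Icc hb hc hm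
    exact ⟨w, hw.1, hwx⟩
  exact ⟨Function.invFunOn_mem hex, Function.invFunOn_eq hex⟩

/-- `W (w eʷ) = w` for every `w ≥ -1`. -/
theorem lambertW_unique {w : ℝ} (hw : -1 ≤ w) : lambertW (w * Real.exp w) = w :=
  strictMonoOn_mul_exp.injOn.leftInvOn_invFunOn hw

/-- `f` is completely monotone on `(0, ∞)`: it has derivatives of all orders there, and
`(-1)ⁿ f⁽ⁿ⁾(x) ≥ 0` for all `n ≥ 0` and `x > 0`. -/
def IsCompletelyMonotone (f : ℝ → ℝ) : Prop :=
  ContDiffOn ℝ ∞ f (Set.Ioi 0) ∧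
    ∀ n : ℕ, ∀ x : ℝ, 0 < x → 0 ≤ (-1 : ℝ) ^ n * iteratedDeriv n f x

/-- `f` is a Bernstein function on `(0, ∞)`: it is nonnegative there, has derivatives of all
orders there, and its derivative is completely monotone. -/
def IsBernstein (f : ℝ → ℝ) : Prop :=
  ContDiffOn ℝ ∞ f (Set.Ioi 0) ∧ (∀ x : ℝ, 0 < x → 0 ≤ f x) ∧ IsCompletelyMonotone (deriv f)

/-! Inverting `w ↦ w eʷ` gives `W' = e^{-W} u` with `u = 1 / (1 + W)`, hence `u' = -e^{-W} u³`.
Differentiating `e^{-(n+1)W} P(u)` therefore yields `-e^{-(n+2)W} u ((n+1) P(u) + u² P'(u))`: the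
sign flips once, and the new polynomial again has nonnegative coefficients. Since `u > 0`, the
derivatives alternate strictly in sign. -/

theorem lambertW_pos {x : ℝ} (hx : 0 < x) : 0 < lambertW x := by
  have h := (lambertW_spec (x := x) (by linarith [Real.exp_pos (-1)])).2
  by_contra! hw
  nlinarith [Real.exp_pos (lambertW x)]

theorem hasDerivAt_lambertW {x : ℝ} (hx : 0 < x) :
    HasDerivAt lambertW (Real.exp (-lambertW x) * (1 + lambertW x)⁻¹) x := by
  have hw := lambertW_pos hx
  have hs := (lambertW_spec (x := x) (by linarith [Real.exp_pos (-1)])).2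
  have hf : HasStrictDerivAt (fun w : ℝ => w * Real.exp w)
      (1 * Real.exp (lambertW x) + lambertW x * Real.exp (lambertW x)) (lambertW x) :=
    (hasStrictDerivAt_id _).mul (Real.hasStrictDerivAt_exp _)
  have hinv : ∀ᶠ w in nhds (lambertW x), lambertW (w * Real.exp w) = w := by
    filter_upwards [lt_mem_nhds hw] with w h using lambertW_unique (by linarith)
  have h := (hf.to_local_left_inverse (by positivity) hinv).hasDerivAt
  have hval : (1 * Real.exp (lambertW x) + lambertW x * Real.exp (lambertW x))⁻¹ =
      Real.exp (-lambertW x) * (1 + lambertW x)⁻¹ := by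
    rw [Real.exp_neg, ← add_mul, mul_inv, mul_comm]
  rwa [hval, hs] at h

/-- Bootstrap: `W'` is a smooth expression in `W`, so `Cⁿ` regularity of `W` passes to `W'`. -/
theorem contDiffOn_lambertW : ContDiffOn ℝ ∞ lambertW (Set.Ioi 0) := by
  refine contDiffOn_infty.2 fun n => ?_
  induction n with
  | zero =>
    exact contDiffOn_zero.2 fun x hx => (hasDerivAt_lambertW hx).continuousAt.continuousWithinAt
  | succ n ih =>
    push_cast
    refine (contDiffOn_succ_iff_deriv_of_isOpen isOpen_Ioi).2
      ⟨fun x hx => (hasDerivAt_lambertW hx).differentiableAt.differentiableWithinAt, fun h => absurd h (WithTop.coe_ne_top (a := (n : ℕ∞))), ?_⟩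
    refine ContDiffOn.congr (f := fun x => Real.exp (-lambertW x) * (1 + lambertW x)⁻¹) ?_
      fun x hx => (hasDerivAt_lambertW hx).deriv
    exact ih.neg.exp.mul ((contDiffOn_const.add ih).inv fun x hx =>
      (by linarith [lambertW_pos hx] : 0 < 1 + lambertW x).ne')

/-- The polynomials `P₀ = X`, `Pₙ₊₁ = X ((n + 1) Pₙ + X² Pₙ')`, for which
`W⁽ⁿ⁺¹⁾ = (-1)ⁿ e^{-(n+1)W} Pₙ(1 / (1 + W))`. -/
noncomputable def lambertPoly : ℕ → Polynomial ℕ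
  | 0 => Polynomial.X
  | n + 1 => Polynomial.X * (Polynomial.C (n + 1) * lambertPoly n +
      Polynomial.X ^ 2 * Polynomial.derivative (lambertPoly n))

theorem Polynomial.aeval_nat_nonneg (p : Polynomial ℕ) {u : ℝ} (hu : 0 ≤ u) :
    0 ≤ Polynomial.aeval u p := by
  rw [Polynomial.aeval_eq_sum_range]
  exact Finset.sum_nonneg fun i _ => nsmul_nonneg (pow_nonneg hu i) _

theorem lambertPoly_aeval_succ (n : ℕ) (u : ℝ) :
    Polynomial.aeval u (lambertPoly (n + 1)) = u * ((n + 1) * Polynomial.aeval u (lambertPoly n) +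
      u ^ 2 * Polynomial.aeval u (Polynomial.derivative (lambertPoly n))) := by
  simp [lambertPoly]

/-- Coefficients in `ℕ` make the `Pₙ'` term nonnegative; the term `(n + 1) Pₙ` keeps positivity
strict. -/
theorem lambertPoly_aeval_pos (n : ℕ) {u : ℝ} (hu : 0 < u) :
    0 < Polynomial.aeval u (lambertPoly n) := by
  induction n with
  | zero => simpa [lambertPoly] using hu
  | succ n ih =>
    have := Polynomial.aeval_nat_nonneg (Polynomial.derivative (lambertPoly n)) hu.le
    rw [lambertPoly_aeval_succ]
    positivity

theorem Polynomial.hasDerivAt_aeval_nat (p : Polynomial ℕ) (u : ℝ) :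
    HasDerivAt (fun v : ℝ => Polynomial.aeval v p)
      (Polynomial.aeval u (Polynomial.derivative p)) u := by
  have h := (p.map (algebraMap ℕ ℝ)).hasDerivAt u
  simpa only [Polynomial.derivative_map, Polynomial.eval_map_algebraMap] using h

theorem iteratedDeriv_succ_lambertW (n : ℕ) {x : ℝ} (hx : 0 < x) :
    iteratedDeriv (n + 1) lambertW x = (-1) ^ n * (Real.exp (-((n + 1) * lambertW x)) *
      Polynomial.aeval (1 + lambertW x)⁻¹ (lambertPoly n)) := by
  induction n generalizing x with
  | zero => simp [(hasDerivAt_lambertW hx).deriv, lambertPoly]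
  | succ n ih =>
    have hW := hasDerivAt_lambertW hx
    have hne : 1 + lambertW x ≠ 0 := by linarith [lambertW_pos hx]
    -- Differentiating the formula requires it near `x`, not only at `x`.
    have hev : iteratedDeriv (n + 1) lambertW =ᶠ[nhds x] fun y =>
        (-1) ^ n * (Real.exp (-((n + 1) * lambertW y)) *
          Polynomial.aeval (1 + lambertW y)⁻¹ (lambertPoly n)) := by
      filter_upwards [lt_mem_nhds hx] with y hy using ih hy
    have hexp := (hW.const_mul ((n : ℝ) + 1)).neg.exp
    have hu := (hW.const_add 1).inv hne
    have hP := (Polynomial.hasDerivAt_aeval_nat (lambertPoly n) (1 + lambertW x)⁻¹).comp x hu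
    have h := (hexp.mul hP).const_mul ((-1 : ℝ) ^ n)
    -- The extra factor `e^{-W}` is the one contributed by `W'`.
    have hadd : Real.exp (-(((n + 1 : ℕ) + 1) * lambertW x)) =
        Real.exp (-((n + 1) * lambertW x)) * Real.exp (-lambertW x) := by
      rw [← Real.exp_add]; push_cast; ring_nf
    rw [iteratedDeriv_succ, hev.deriv_eq, lambertPoly_aeval_succ, hadd]
    refine h.deriv.trans ?_
    simp only [Function.comp_apply, Pi.neg_apply, Pi.inv_apply]
    rw [div_eq_mul_inv, ← inv_pow]
    ring

theorem iteratedDeriv_succ_lambertW_sign (n : ℕ) {x : ℝ} (hx : 0 < x) :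
    0 < (-1 : ℝ) ^ n * iteratedDeriv (n + 1) lambertW x := by
  have hw := lambertW_pos hx
  have hP := lambertPoly_aeval_pos n (u := (1 + lambertW x)⁻¹) (by positivity)
  rw [iteratedDeriv_succ_lambertW n hx, ← mul_assoc, ← mul_pow]
  norm_num
  positivity

theorem isCompletelyMonotone_deriv_lambertW : IsCompletelyMonotone (deriv lambertW) :=
  ⟨((contDiffOn_infty_iff_deriv_of_isOpen isOpen_Ioi).1 contDiffOn_lambertW).2, fun n x hx => by
    rw [← iteratedDeriv_succ']
    exact (iteratedDeriv_succ_lambertW_sign n hx).le⟩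

theorem mainTheorem2 :
    (∀ x : ℝ, 0 < x → 0 < lambertW x) ∧
    (∀ n : ℕ, 1 ≤ n → ∀ x : ℝ, 0 < x →
      0 < (-1 : ℝ) ^ (n - 1) * iteratedDeriv n lambertW x) ∧
    IsCompletelyMonotone (deriv lambertW) ∧
    IsBernstein lambertW := by
  refine ⟨fun x hx => lambertW_pos hx, fun n hn x hx => ?_, isCompletelyMonotone_deriv_lambertW,
    contDiffOn_lambertW, fun x hx => (lambertW_pos hx).le, isCompletelyMonotone_deriv_lambertW⟩
  obtain ⟨m, rfl⟩ := Nat.exists_eq_add_of_le' hn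
  exact iteratedDeriv_succ_lambertW_sign m hx
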